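/- **Setting.** Fix a finite set $\mathcal V$ of qubit variables with state space $\mathcal H=\bigotimes_{q\in\mathcal V}\mathbb C^2$. Nondeterministic quantum programs are generated by $$S::=\mathbf{skip}\mid\mathbf{abort}\mid\bar q:=0\mid\bar q\mathrel{*\!\!=}U\mid S_0;S_1\mid S_0\,\square\,S_1\mid\mathbf{if}\ \mathcal M[\bar q]\ \mathbf{then}\ S_1\ \mathbf{else}\ S_0\ \mathbf{end}\mid\mathbf{while}\ \mathcal M[\bar q]\ \mathbf{do}\ S\ \mathbf{end},$$ where $\bar q$ is a tuple of distinct variables, $U$ is a unitary and $\mathcal M=\{P^0,P^1\}$ a two-outcome projective measurement on the qubits $\bar q$. A subscript $\bar q$ denotes the extension of an operator by the identity on the other qubits, and $\mathcal P^i(\rho)=P^i_{\bar q}\rho P^i_{\bar q}$. The semantics $[\![S]\!]$ is the set of super-operators on $\mathcal H$ given by $[\![\mathbf{skip}]\!]=\{\mathrm{id}\}$; $[\![\mathbf{abort}]\!]=\{0\}$; $[\![\bar q:=0]\!]=\{\rho\mapsto\sum_i|0\rangle_{\bar q}\langle i|\rho|i\rangle_{\bar q}\langle 0|\}$; $[\![\bar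 q\mathrel{*\!\!=}U]\!]=\{\rho\mapsto U_{\bar q}\rho U_{\bar q}^\dagger\}$; $[\![S_0;S_1]\!]=\{\mathcal F\circ\mathcal E:\mathcal E\in[\![S_0]\!],\mathcal F\in[\![S_1]\!]\}$; $[\![S_0\,\square\,S_1]\!]=[\![S_0]\!]\cup[\![S_1]\!]$; $[\![\mathbf{if}\ldots]\!]=\{\mathcal E\circ\mathcal P^0+\mathcal F\circ\mathcal P^1:\mathcal E\in[\![S_0]\!],\mathcal F\in[\![S_1]\!]\}$; and $[\![\mathbf{while}\ \mathcal M[\bar q]\ \mathbf{do}\ S\ \mathbf{end}]\!]=\{\sum_{k\ge0}\mathcal P^0\circ\eta_k\circ\mathcal P^1\circ\cdots\circ\eta_1\circ\mathcal P^1:\eta\in[\![S]\!]^{\mathbb N}\}$. The sequences $\eta=(\eta_1,\eta_2,\dots)\in[\![S]\!]^{\mathbb N}$ are called schedulers, and $\eta^{\rightarrow}=(\eta_2,\eta_3,\dots)$. A quantum predicate is an operator $M$ with $0\sqsubseteq M\sqsubseteq I$ (Löwner order); a quantum assertion is a set of quantum predicates. For a partial density operator $\rho$ (positive, trace at most $1$)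 put $\mathrm{Exp}(\rho\models\Theta)=\inf_{M\in\Theta}\mathrm{tr}(M\rho)$ (with $\inf\emptyset=+\infty$). Write $\Theta\sqsubseteq_{\mathit{inf}}\Psi$ if $\mathrm{Exp}(\rho\models\Theta)\le\mathrm{Exp}(\rho\models\Psi)$ for all $\rho$, and $\models_{\mathrm{tot}}\{\Theta\}S\{\Psi\}$ if $\mathrm{Exp}(\rho\models\Theta)\le\inf\{\mathrm{Exp}(\mathcal E(\rho)\models\Psi):\mathcal E\in[\![S]\!]\}$ for all $\rho$. Operations on predicates extend to assertions element-wise, and a predicate stands for its singleton. A $\widehat\Theta$-ranking assertion for $\mathbf{while}\ \mathcal M[\bar q]\ \mathbf{do}\ S\ \mathbf{end}$ is a family of quantum predicates $R_i^\eta$ ($i\ge0$, $\eta\in[\![S]\!]^{\mathbb N}$) such that for every $\eta$: (1) $\widehat\Theta\sqsubseteq_{\mathit{inf}}R_0^\eta$; (2) $R_0^\eta\sqsupseteq R_1^\eta\sqsupseteq\cdots$ and $\bigwedge_iR_i^\eta=0$; (3) $\mathrm{tr}(R_i^{\eta^{\rightarrow}}\,\eta_1(\mathcal P^1(\rho)))\le\mathrm{tr}(R_{i+1}^\eta\rho)$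 for all $i$ and all partial density operators $\rho$. Let $\vdash_{\mathrm{tot}}$ be derivability from the following rules: - (Skip) $\{\Theta\}\mathbf{skip}\{\Theta\}$; (AbortT) $\{0\}\mathbf{abort}\{0\}$; (Init) $\{\sum_i|i\rangle_{\bar q}\langle0|\Theta|0\rangle_{\bar q}\langle i|\}\,\bar q:=0\,\{\Theta\}$; (Unit) $\{U_{\bar q}^\dagger\Theta U_{\bar q}\}\,\bar q\mathrel{*\!\!=}U\,\{\Theta\}$. - (Seq) From $\{\Theta\}S_0\{\Theta'\}$ and $\{\Theta'\}S_1\{\Psi\}$ infer $\{\Theta\}S_0;S_1\{\Psi\}$. - (NDet) From $\{\Theta\}S_0\{\Psi\}$ and $\{\Theta\}S_1\{\Psi\}$ infer $\{\Theta\}S_0\,\square\,S_1\{\Psi\}$. - (Meas) From $\{\Theta_1\}S_1\{\Psi\}$ and $\{\Theta_0\}S_0\{\Psi\}$ infer $\{\mathcal P^0(\Theta_0)+\mathcal P^1(\Theta_1)\}\,\mathbf{if}\ \mathcal M[\bar q]\ \mathbf{then}\ S_1\ \mathbf{else}\ S_0\ \mathbf{end}\,\{\Psi\}$. - (WhileT)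 From $\{\Theta\}S\{\mathcal P^0(\Psi)+\mathcal P^1(\Theta)\}$, if a $(\mathcal P^0(\Psi)+\mathcal P^1(\Theta))$-ranking assertion for the loop exists, infer $\{\mathcal P^0(\Psi)+\mathcal P^1(\Theta)\}\,\mathbf{while}\ \mathcal M[\bar q]\ \mathbf{do}\ S\ \mathbf{end}\,\{\Psi\}$. - (Imp) From $\Theta\sqsubseteq_{\mathit{inf}}\Theta'$, $\{\Theta'\}S\{\Psi'\}$ and $\Psi'\sqsubseteq_{\mathit{inf}}\Psi$ infer $\{\Theta\}S\{\Psi\}$. - (Union) From $\{\Theta_i\}S\{\Psi_i\}$ for all $i\in I$ ($I$ any index set) infer $\{\bigcup_{i\in I}\Theta_i\}S\{\bigcup_{i\in I}\Psi_i\}$. **Theorem.** The proof system is sound and relatively complete for total correctness: for every program $S$ and all quantum assertions $\Theta,\Psi$, $$\vdash_{\mathrm{tot}}\{\Theta\}S\{\Psi\}\iff\models_{\mathrm{tot}}\{\Theta\}S\{\Psi\}.$$ Moreover, for every loop $W=\mathbf{while}\ \mathcal M[\bar q]\ \mathbf{do}\ S\ \mathbf{end}$ and all $i,\eta$ the series $$R_i^\eta=\sum_{k=i}^\infty\mathcal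 P^1\circ\eta_1^\dagger\circ\cdots\circ\mathcal P^1\circ\eta_k^\dagger\circ\mathcal P^0(I)$$ (where $\mathcal E^\dagger$ is the adjoint of $\mathcal E$, determined by $\mathrm{tr}(\mathcal E(A)B)=\mathrm{tr}(A\,\mathcal E^\dagger(B))$) converges to a quantum predicate, and these predicates form a $\widehat\Theta$-ranking assertion for $W$ whenever $\models_{\mathrm{tot}}\{\widehat\Theta\}W\{\Psi\}$ for some nonempty $\Psi$; in particular when $\widehat\Theta$ is the weakest precondition of a nonempty $\Psi$. -/

import Mathlib

universe u

noncomputable section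

namespace NQP

open scoped MatrixOrder ComplexOrder Kronecker

/- ## Hilbert spaces and operators

A finite set `V` of qubit variables is fixed.  The computational basis of the state space
`⨂_{q ∈ V} ℂ²` is indexed by `V → Fin 2`, and operators are written as matrices in this basis.
The order `≤` on matrices is the Löwner order: `A ≤ B` iff `B - A` is positive semidefinite. -/

/-- Basis states of a family of qubits indexed by `ι`. -/
abbrev Bits (ι : Type u) : Type u := ι → Fin 2

/-- Linear operators on the state space of the qubits in `V`. -/
abbrev Op (V : Type u) : Type u := Matrix (Bits V) (Bits V) ℂ

/-- Linear maps on operators. -/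
abbrev SuperOp (V : Type u) : Type u := Op V →ₗ[ℂ] Op V

section
variable {V : Type u} [Fintype V] [DecidableEq V]

/-- Splitting a basis state into its bits at the tuple `q` of distinct variables and the bits
at the remaining variables. -/
def split {n : ℕ} (q : Fin n ↪ V) : Bits V ≃ Bits (Fin n) × Bits {v : V // ¬ ∃ i, q i = v} :=
  (Equiv.piEquivPiSubtypeProd (fun v : V => ∃ i, q i = v) (fun _ => Fin 2)).trans
    (Equiv.prodCongr
      (Equiv.arrowCongr (Equiv.ofInjective q q.injective).symm (Equiv.refl (Fin 2)))
      (Equiv.refl _))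

/-- The cylinder extension `A_q`: the operator `A` on the tuple `q`, tensored with the identity
on the remaining variables. -/
def cyl {n : ℕ} (q : Fin n ↪ V) (A : Op (Fin n)) : Op V :=
  (A ⊗ₖ (1 : Op {v : V // ¬ ∃ i, q i = v})).submatrix (split q) (split q)

/-- The map `ρ ↦ A ρ A†`. -/
def conj (A : Op V) : SuperOp V where
  toFun ρ := A * ρ * A.conjTranspose
  map_add' ρ σ := by rw [Matrix.mul_add, Matrix.add_mul]
  map_smul' c ρ := by simp

/-- The adjoint `E†` of a super-operator, determined by `tr (E(A) B) = tr (A E†(B))`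
(see `trace_adj`). -/
def adj (E : SuperOp V) : SuperOp V where
  toFun B := Matrix.of fun i j => (E (Matrix.single j i 1) * B).trace
  map_add' B C := by ext i j; simp [Matrix.mul_add]
  map_smul' c B := by ext i j; simp

theorem trace_adj (E : SuperOp V) (A B : Op V) :
    (E A * B).trace = (A * adj E B).trace := by
  conv_lhs => rw [Matrix.matrix_eq_sum_single A]
  simp only [map_sum, Finset.sum_mul, Matrix.trace_sum]
  simp only [Matrix.trace, Matrix.diag, Matrix.mul_apply (M := A), adj, LinearMap.coe_mk,
    AddHom.coe_mk, Matrix.of_apply]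
  refine Finset.sum_congr rfl fun i _ => Finset.sum_congr rfl fun j _ => ?_
  have h : Matrix.single i j (A i j) = A i j • Matrix.single i j (1 : ℂ) := by simp
  rw [h, map_smul, Matrix.smul_mul]
  simp only [Matrix.smul_apply, smul_eq_mul, Finset.mul_sum]

theorem cyl_mul {n : ℕ} (q : Fin n ↪ V) (A B : Op (Fin n)) :
    cyl q (A * B) = cyl q A * cyl q B := by
  unfold cyl
  rw [Matrix.submatrix_mul_equiv, ← Matrix.mul_kronecker_mul, Matrix.one_mul]

theorem cyl_one {n : ℕ} (q : Fin n ↪ V) : cyl q (1 : Op (Fin n)) = 1 := by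
  simp [cyl]

theorem cyl_add {n : ℕ} (q : Fin n ↪ V) (A B : Op (Fin n)) :
    cyl q (A + B) = cyl q A + cyl q B := by
  simp [cyl, Matrix.add_kronecker, Matrix.submatrix_add]

theorem cyl_sum {n : ℕ} (q : Fin n ↪ V) {ι : Type*} (s : Finset ι) (A : ι → Op (Fin n)) :
    cyl q (∑ i ∈ s, A i) = ∑ i ∈ s, cyl q (A i) := by
  classical
  induction s using Finset.induction_on with
  | empty => simp [cyl]
  | insert a s ha ih => rw [Finset.sum_insert ha, Finset.sum_insert ha, cyl_add, ih]

theorem cyl_conjTranspose {n : ℕ} (q : Fin n ↪ V) (A : Op (Fin n)) :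
    cyl q A.conjTranspose = (cyl q A).conjTranspose := by
  simp [cyl, Matrix.conjTranspose_submatrix, Matrix.conjTranspose_kronecker]

end

/- ## Programs -/

/-- Two-outcome projective measurements on `n` qubits. -/
structure Measurement (n : ℕ) where
  P0 : Op (Fin n)
  P1 : Op (Fin n)
  herm0 : P0.conjTranspose = P0
  herm1 : P1.conjTranspose = P1
  idem0 : P0 * P0 = P0
  idem1 : P1 * P1 = P1
  complete : P0 + P1 = 1

/-- Nondeterministic quantum programs over the variables `V`; a tuple of `n` distinct variables
is an embedding `Fin n ↪ V`.  `ite q M S₁ S₀` is `if M[q] then S₁ else S₀ end`. -/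
inductive Prog (V : Type u) : Type u
  | skip : Prog V
  | abort : Prog V
  | init {n : ℕ} (q : Fin n ↪ V) : Prog V
  | unit {n : ℕ} (q : Fin n ↪ V) (U : Matrix.unitaryGroup (Bits (Fin n)) ℂ) : Prog V
  | seq (S₀ S₁ : Prog V) : Prog V
  | choice (S₀ S₁ : Prog V) : Prog V
  | ite {n : ℕ} (q : Fin n ↪ V) (M : Measurement n) (S₁ S₀ : Prog V) : Prog V
  | while {n : ℕ} (q : Fin n ↪ V) (M : Measurement n) (S : Prog V) : Prog V

section
variable {V : Type u} [Fintype V] [DecidableEq V]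

/-- The super-operator `ρ ↦ P⁰_q ρ P⁰_q`. -/
def meas0 {n : ℕ} (q : Fin n ↪ V) (M : Measurement n) : SuperOp V := conj (cyl q M.P0)

/-- The super-operator `ρ ↦ P¹_q ρ P¹_q`. -/
def meas1 {n : ℕ} (q : Fin n ↪ V) (M : Measurement n) : SuperOp V := conj (cyl q M.P1)

/-- Initialisation of `q`: the super-operator `ρ ↦ ∑ i, |0⟩_q⟨i| ρ |i⟩_q⟨0|`. -/
def setZero {n : ℕ} (q : Fin n ↪ V) : SuperOp V :=
  ∑ i : Bits (Fin n), conj (cyl q (Matrix.single 0 i 1))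

/-- `η_k ∘ P¹ ∘ ⋯ ∘ η_1 ∘ P¹`, where `η_j` is written `η (j - 1)`. -/
def loopIter {n : ℕ} (q : Fin n ↪ V) (M : Measurement n) (η : ℕ → SuperOp V) : ℕ → SuperOp V
  | 0 => LinearMap.id
  | k + 1 => η k ∘ₗ meas1 q M ∘ₗ loopIter q M η k

/-- The denotational semantics.  The infinite sum for a loop converges pointwise. -/
def sem : Prog V → Set (SuperOp V)
  | .skip => {LinearMap.id}
  | .abort => {0}
  | .init q => {setZero q}
  | .unit q U => {conj (cyl q U.1)}
  | .seq S₀ S₁ => {G | ∃ E ∈ sem S₀, ∃ F ∈ sem S₁, G = F ∘ₗ E}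
  | .choice S₀ S₁ => sem S₀ ∪ sem S₁
  | .ite q M S₁ S₀ =>
      {G | ∃ E ∈ sem S₀, ∃ F ∈ sem S₁, G = E ∘ₗ meas0 q M + F ∘ₗ meas1 q M}
  | .while q M S =>
      {G | ∃ η : ℕ → SuperOp V, (∀ i, η i ∈ sem S) ∧
        ∀ ρ : Op V, HasSum (fun k => meas0 q M (loopIter q M η k ρ)) (G ρ)}

/- ## Assertions and correctness formulas -/

/-- Partial density operators. -/
def IsState (ρ : Op V) : Prop := ρ.PosSemidef ∧ ρ.trace.re ≤ 1

variable (V) in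
/-- Quantum predicates: operators `M` with `0 ⊑ M ⊑ I`. -/
abbrev QPred : Type u := {M : Op V // 0 ≤ M ∧ M ≤ 1}

variable (V) in
/-- Quantum assertions: arbitrary sets of quantum predicates. -/
abbrev Assertion : Type u := Set (QPred V)

/-- The real number `tr (M ρ)`. -/
def expect (M ρ : Op V) : ℝ := (M * ρ).trace.re

/-- `Exp(ρ ⊨ Θ) = inf {tr (M ρ) : M ∈ Θ}`, with `inf ∅ = +∞`. -/
def Exp (ρ : Op V) (Θ : Assertion V) : EReal :=
  ⨅ M ∈ Θ, (expect M.1 ρ : EReal)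

/-- The pre-order `Θ ⊑_inf Ψ`. -/
def LeInf (Θ Ψ : Assertion V) : Prop := ∀ ρ : Op V, IsState ρ → Exp ρ Θ ≤ Exp ρ Ψ

/-- Total correctness `⊨_tot {Θ} S {Ψ}`. -/
def ValidTot (Θ : Assertion V) (S : Prog V) (Ψ : Assertion V) : Prop :=
  ∀ ρ : Op V, IsState ρ → Exp ρ Θ ≤ ⨅ σ ∈ (fun E : SuperOp V => E ρ) '' sem S, Exp σ Ψ

/- ## Operations on predicates used in the proof rules -/

theorem conj_nonneg (A : Op V) {M : Op V} (h : 0 ≤ M) : 0 ≤ conj A M :=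
  (Matrix.PosSemidef.mul_mul_conjTranspose_same (Matrix.nonneg_iff_posSemidef.mp h) A).nonneg

theorem conj_le (A : Op V) {M : Op V} (h : M ≤ 1) : conj A M ≤ A * A.conjTranspose := by
  have := conj_nonneg A (sub_nonneg.mpr h)
  rw [map_sub] at this
  have h2 := sub_nonneg.mp this
  simpa [conj] using h2

instance : Zero (QPred V) := ⟨⟨0, le_refl _, zero_le_one⟩⟩

/-- `∑ i, |i⟩_q⟨0| M |0⟩_q⟨i|`. -/
def initPred {n : ℕ} (q : Fin n ↪ V) (M : QPred V) : QPred V :=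
  ⟨∑ i : Bits (Fin n), conj (cyl q (Matrix.single i 0 1)) M.1, by
    refine ⟨Finset.sum_nonneg fun i _ => conj_nonneg _ M.2.1, ?_⟩
    refine (Finset.sum_le_sum fun i _ => conj_le _ M.2.2).trans (le_of_eq ?_)
    simp only [← cyl_conjTranspose, ← cyl_mul, ← cyl_sum]
    rw [← cyl_one q]
    congr 1
    simp [Matrix.sum_single_one]⟩

/-- `U_q† M U_q`. -/
def unitPred {n : ℕ} (q : Fin n ↪ V) (U : Matrix.unitaryGroup (Bits (Fin n)) ℂ)
    (M : QPred V) : QPred V :=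
  ⟨(cyl q U.1).conjTranspose * M.1 * cyl q U.1, by
    have h := conj_nonneg (cyl q U.1).conjTranspose M.2.1
    have h1 := conj_le (cyl q U.1).conjTranspose M.2.2
    have hU : (U.1).conjTranspose * U.1 = 1 := Matrix.mem_unitaryGroup_iff'.mp U.2
    simp only [conj, LinearMap.coe_mk, AddHom.coe_mk, Matrix.conjTranspose_conjTranspose] at h h1
    rw [← cyl_conjTranspose, ← cyl_mul, hU, cyl_one] at h1
    rw [← cyl_conjTranspose] at h ⊢
    exact ⟨h, h1⟩⟩

/-- `P⁰_q(N) + P¹_q(T)`. -/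
def measPred {n : ℕ} (q : Fin n ↪ V) (M : Measurement n) (N T : QPred V) : QPred V :=
  ⟨meas0 q M N.1 + meas1 q M T.1, by
    refine ⟨add_nonneg (conj_nonneg _ N.2.1) (conj_nonneg _ T.2.1), ?_⟩
    refine (add_le_add (conj_le _ N.2.2) (conj_le _ T.2.2)).trans (le_of_eq ?_)
    rw [← cyl_conjTranspose, ← cyl_conjTranspose, M.herm0, M.herm1, ← cyl_mul, ← cyl_mul,
      M.idem0, M.idem1, ← cyl_add, M.complete, cyl_one]⟩

/-- The assertion `P⁰_q(Θ₀) + P¹_q(Θ₁)`, formed element-wise. -/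
def measAssert {n : ℕ} (q : Fin n ↪ V) (M : Measurement n) (Θ₀ Θ₁ : Assertion V) :
    Assertion V :=
  {A | ∃ N ∈ Θ₀, ∃ T ∈ Θ₁, A = measPred q M N T}

/- ## Ranking assertions -/

/-- Schedulers for a loop with body `S`; the index starts at `0`. -/
abbrev Scheduler (S : Prog V) : Type u := ℕ → {E : SuperOp V // E ∈ sem S}

/-- The scheduler `η` without its first element. -/
def Scheduler.tail {S : Prog V} (η : Scheduler S) : Scheduler S := fun i => η (i + 1)

/-- `R` is a `Θ`-ranking assertion for `while M[q] do S end`. -/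
structure IsRanking {n : ℕ} (q : Fin n ↪ V) (M : Measurement n) (S : Prog V)
    (Θ : Assertion V) (R : ℕ → Scheduler S → QPred V) : Prop where
  bound : ∀ η, LeInf Θ {R 0 η}
  decreasing : ∀ η i, (R (i + 1) η).1 ≤ (R i η).1
  inf_zero : ∀ η, IsGLB (Set.range fun i => (R i η).1) 0
  step : ∀ η i (ρ : Op V), IsState ρ →
    expect (R i (Scheduler.tail η)).1 ((η 0).1 (meas1 q M ρ)) ≤ expect (R (i + 1) η).1 ρ

/-- `P¹ ∘ η_1† ∘ ⋯ ∘ P¹ ∘ η_k†`, where `η_j` is written `η (j - 1)`. -/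
def backIter {n : ℕ} (q : Fin n ↪ V) (M : Measurement n) (η : ℕ → SuperOp V) : ℕ → SuperOp V
  | 0 => LinearMap.id
  | k + 1 => backIter q M η k ∘ₗ meas1 q M ∘ₗ adj (η k)

/-- `P¹ ∘ η_1† ∘ ⋯ ∘ P¹ ∘ η_k† ∘ P⁰ (I)`: its expectation in `ρ` is the probability that the
loop, run from `ρ` under `η`, terminates after exactly `k` iterations of the body. -/
def termOp {n : ℕ} (q : Fin n ↪ V) (M : Measurement n) {S : Prog V} (η : Scheduler S)
    (k : ℕ) : Op V :=
  backIter q M (fun i => (η i).1) k (meas0 q M 1)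

/- ## The proof system for total correctness -/

/-- Derivability `⊢_tot {Θ} S {Ψ}`.  The side conditions of `imp` and `whileT` are semantic, and
`union` may have any number of premises. -/
inductive ProvableTot : Assertion V → Prog V → Assertion V → Prop
  | skip (Θ : Assertion V) : ProvableTot Θ .skip Θ
  | abortT : ProvableTot {0} .abort {0}
  | init {n : ℕ} (q : Fin n ↪ V) (Θ : Assertion V) :
      ProvableTot (initPred q '' Θ) (.init q) Θ
  | unit {n : ℕ} (q : Fin n ↪ V) (U : Matrix.unitaryGroup (Bits (Fin n)) ℂ) (Θ : Assertion V) :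
      ProvableTot (unitPred q U '' Θ) (.unit q U) Θ
  | seq {S₀ S₁ : Prog V} {Θ Θ' Ψ : Assertion V} :
      ProvableTot Θ S₀ Θ' → ProvableTot Θ' S₁ Ψ → ProvableTot Θ (.seq S₀ S₁) Ψ
  | ndet {S₀ S₁ : Prog V} {Θ Ψ : Assertion V} :
      ProvableTot Θ S₀ Ψ → ProvableTot Θ S₁ Ψ → ProvableTot Θ (.choice S₀ S₁) Ψ
  | meas {n : ℕ} (q : Fin n ↪ V) (M : Measurement n) {S₁ S₀ : Prog V}
      {Θ₀ Θ₁ Ψ : Assertion V} :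
      ProvableTot Θ₁ S₁ Ψ → ProvableTot Θ₀ S₀ Ψ →
      ProvableTot (measAssert q M Θ₀ Θ₁) (.ite q M S₁ S₀) Ψ
  | whileT {n : ℕ} (q : Fin n ↪ V) (M : Measurement n) {S : Prog V} {Θ Ψ : Assertion V} :
      ProvableTot Θ S (measAssert q M Ψ Θ) →
      (∃ R : ℕ → Scheduler S → QPred V, IsRanking q M S (measAssert q M Ψ Θ) R) →
      ProvableTot (measAssert q M Ψ Θ) (.while q M S) Ψ
  | imp {S : Prog V} {Θ Θ' Ψ' Ψ : Assertion V} :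
      LeInf Θ Θ' → ProvableTot Θ' S Ψ' → LeInf Ψ' Ψ → ProvableTot Θ S Ψ
  -- An index type in `Type u` is general enough: pairs of assertions themselves form one.
  | union {S : Prog V} {I : Type u} (Θ Ψ : I → Assertion V) :
      (∀ i, ProvableTot (Θ i) S (Ψ i)) → ProvableTot (⋃ i, Θ i) S (⋃ i, Ψ i)

end

end NQP

end

namespace NQP

open scoped MatrixOrder ComplexOrder

section
variable {V : Type u} [Fintype V] [DecidableEq V]

/-! Expectations may be infinite, so `Exp ρ Θ ≤ Exp σ Ψ` is read as: every real lower bound of `tr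
(M ρ)` over `Θ` is one of `tr (N σ)` over `Ψ` (`exp_le_exp_iff`). All of soundness and completeness
is then real arithmetic with lower bounds.

Soundness of the loop rule: fix `N ∈ Ψ` and a scheduler. If `c` bounds the precondition at `ρ`, then
`c` minus the `N`-expectation of what has already left the loop bounds the invariant on the state
after `k` iterations. The ranking assertion bounds this difference by `tr (R_k ρ)`, which tends to
`0`, so `c` is at most the `N`-expectation of the output (`validTot_while`).

Completeness: by duality, validity is `Θ ⊑_inf wp S Ψ` with `wp S Ψ = {E†(N)}`, so it suffices to
derive the weakest precondition (`ProvableTot.wp`, by induction on `S`). The Union rule reduces this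
to singleton postconditions where needed. For a loop, `wp` solves the fixed-point equation
`isLowerExp_wp_while`, and the tails of the termination series form a ranking assertion
(`isRanking_of_hasSum`). -/

/-- Positive, trace-nonincreasing super-operators. -/
def IsSubnormal (E : SuperOp V) : Prop :=
  ∀ ρ : Op V, ρ.PosSemidef → (E ρ).PosSemidef ∧ (E ρ).trace.re ≤ ρ.trace.re

/-- `c` is a lower bound of `tr (M ρ)` for `M ∈ Θ`. -/
def IsLowerExp (c : ℝ) (ρ : Op V) (Θ : Assertion V) : Prop := ∀ M ∈ Θ, c ≤ expect M.1 ρ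

/- ## Positive semidefinite matrices -/

theorem trace_mul_nonneg {A B : Op V} (hA : A.PosSemidef) (hB : B.PosSemidef) :
    0 ≤ (A * B).trace := by
  obtain ⟨C, rfl⟩ := CStarAlgebra.nonneg_iff_eq_star_mul_self.mp hB.nonneg
  rw [Matrix.star_eq_conjTranspose, ← Matrix.mul_assoc, Matrix.trace_mul_comm, ← Matrix.mul_assoc]
  exact (hA.mul_mul_conjTranspose_same C).trace_nonneg

/-- Rank-one `ρ = x x*` suffice as tests. Nonnegativity in `ℂ` includes being real, so no Hermitian
hypothesis is needed. -/
theorem posSemidef_of_trace_mul_nonneg {A : Op V}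
    (h : ∀ ρ : Op V, ρ.PosSemidef → 0 ≤ (A * ρ).trace) : A.PosSemidef := by
  rw [← Matrix.isPositive_toEuclideanLin_iff, LinearMap.isPositive_iff_complex]
  intro x
  have h1 := h _ (Matrix.posSemidef_vecMulVec_self_star x.ofLp)
  rw [Matrix.mul_vecMulVec, Matrix.trace_vecMulVec] at h1
  have h2 : inner ℂ (Matrix.toEuclideanLin A x) x = star (A.mulVec x.ofLp ⬝ᵥ star x.ofLp) := by
    rw [← inner_conj_symm, EuclideanSpace.inner_eq_star_dotProduct]
    simp [Matrix.toLpLin_apply]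
  obtain ⟨hr, hi⟩ := Complex.nonneg_iff.mp h1
  rw [h2]
  refine ⟨Complex.ext (by simp) (by simp [← hi]), by simpa using hr⟩

/-- With `A = C* C`, the entry is an inner product of columns of `C`, hence at most the mean of `A i
i` and `A j j`. The mean also covers `i = j`. -/
theorem norm_apply_le_trace {A : Op V} (hA : A.PosSemidef) (i j : Bits V) :
    ‖A i j‖ ≤ A.trace.re := by
  have hd : ∀ k, 0 ≤ (A k k).re := fun k => (Complex.nonneg_iff.mp hA.diag_nonneg).1
  have hk : ∀ k, (A k k).re ≤ A.trace.re := fun k => by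
    rw [Matrix.trace, Complex.re_sum]
    exact Finset.single_le_sum (f := fun k => (A k k).re) (fun k _ => hd k) (Finset.mem_univ k)
  obtain ⟨C, hC⟩ := CStarAlgebra.nonneg_iff_eq_star_mul_self.mp hA.nonneg
  have he : ∀ i j, A i j = ∑ k, star (C k i) * C k j := fun i j => by
    rw [hC]; simp [Matrix.mul_apply]
  have hs : ∀ i, (A i i).re = ∑ k, ‖C k i‖ ^ 2 := fun i => by
    rw [he, Complex.re_sum]
    refine Finset.sum_congr rfl fun k _ => ?_
    rw [Complex.star_def, Complex.conj_mul']
    norm_cast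
  have h1 : ‖A i j‖ ≤ ∑ k, (‖C k i‖ ^ 2 + ‖C k j‖ ^ 2) / 2 := by
    rw [he]
    refine (norm_sum_le _ _).trans (Finset.sum_le_sum fun k _ => ?_)
    rw [norm_mul, norm_star]
    nlinarith [sq_nonneg (‖C k i‖ - ‖C k j‖)]
  rw [← Finset.sum_div, Finset.sum_add_distrib, ← hs, ← hs] at h1
  linarith [hk i, hk j]

theorem summable_of_trace_le {f : ℕ → Op V} {c : ℝ} (hf : ∀ k, (f k).PosSemidef)
    (hc : ∀ n, ∑ k ∈ Finset.range n, (f k).trace.re ≤ c) : Summable f := by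
  have hs : Summable fun k => (f k).trace.re :=
    summable_of_sum_range_le (fun k => (Complex.nonneg_iff.mp (hf k).trace_nonneg).1) hc
  refine Pi.summable.mpr fun i => Pi.summable.mpr fun j => ?_
  exact Summable.of_norm_bounded hs fun k => norm_apply_le_trace (hf k) i j

/- ## Expectations -/

theorem expect_add_left (M N ρ : Op V) : expect (M + N) ρ = expect M ρ + expect N ρ := by
  simp [expect, Matrix.add_mul]

theorem expect_add_right (M ρ σ : Op V) : expect M (ρ + σ) = expect M ρ + expect M σ := by
  simp [expect, Matrix.mul_add]

theorem expect_sub_left (M N ρ : Op V) : expect (M - N) ρ = expect M ρ - expect N ρ := by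
  simp [expect, Matrix.sub_mul]

theorem expect_one (ρ : Op V) : expect 1 ρ = ρ.trace.re := by simp [expect]

theorem expect_adj (E : SuperOp V) (M ρ : Op V) : expect (adj E M) ρ = expect M (E ρ) := by
  rw [expect, expect, Matrix.trace_mul_comm, ← trace_adj, Matrix.trace_mul_comm]

theorem trace_conj_mul (A M ρ : Op V) :
    (conj A M * ρ).trace = (M * conj A.conjTranspose ρ).trace := by
  simp only [conj, LinearMap.coe_mk, AddHom.coe_mk, Matrix.conjTranspose_conjTranspose]
  rw [Matrix.mul_assoc, Matrix.mul_assoc, Matrix.trace_mul_comm]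
  simp only [Matrix.mul_assoc]

theorem expect_nonneg {M ρ : Op V} (hM : 0 ≤ M) (hρ : ρ.PosSemidef) : 0 ≤ expect M ρ :=
  (Complex.nonneg_iff.mp (trace_mul_nonneg (Matrix.nonneg_iff_posSemidef.mp hM) hρ)).1

theorem expect_mono {M N ρ : Op V} (h : M ≤ N) (hρ : ρ.PosSemidef) : expect M ρ ≤ expect N ρ := by
  have := expect_nonneg (sub_nonneg.mpr h) hρ
  rw [expect_sub_left] at this
  linarith

theorem hasSum_expect_left {f : ℕ → Op V} {A : Op V} (h : HasSum f A) (ρ : Op V) :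
    HasSum (fun k => expect (f k) ρ) (expect A ρ) := by
  refine h.map (AddMonoidHom.mk' (fun M => expect M ρ) fun M N => expect_add_left M N ρ) ?_
  change Continuous fun M : Op V => (M * ρ).trace.re
  fun_prop

theorem hasSum_expect_right {f : ℕ → Op V} {A : Op V} (h : HasSum f A) (M : Op V) :
    HasSum (fun k => expect M (f k)) (expect M A) := by
  refine h.map (AddMonoidHom.mk' (fun ρ => expect M ρ) fun ρ σ => expect_add_right M ρ σ) ?_
  change Continuous fun ρ : Op V => (M * ρ).trace.re
  fun_prop

/-- `expect` keeps only the real part of the trace and is blind to a skew-Hermitian part of `B - A`;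
hence the Hermitian hypothesis. -/
theorem le_of_expect_le {A B : Op V} (hAB : (B - A).IsHermitian)
    (h : ∀ ρ : Op V, ρ.PosSemidef → expect A ρ ≤ expect B ρ) : A ≤ B := by
  rw [Matrix.le_iff]
  refine posSemidef_of_trace_mul_nonneg fun ρ hρ => Complex.nonneg_iff.mpr ⟨?_, ?_⟩
  · have := h ρ hρ
    have h2 := expect_sub_left B A ρ
    rw [expect] at h2
    linarith
  · have h1 : star ((B - A) * ρ).trace = ((B - A) * ρ).trace := by
      rw [← Matrix.trace_conjTranspose, Matrix.conjTranspose_mul, hAB, hρ.isHermitian,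
        Matrix.trace_mul_comm]
    exact (Complex.conj_eq_iff_im.mp h1).symm

theorem IsState.map {E : SuperOp V} (hE : IsSubnormal E) {ρ : Op V} (hρ : IsState ρ) :
    IsState (E ρ) :=
  ⟨(hE ρ hρ.1).1, (hE ρ hρ.1).2.trans hρ.2⟩

theorem posSemidef_adj {E : SuperOp V} (hE : IsSubnormal E) {M : Op V} (hM : M.PosSemidef) :
    (adj E M).PosSemidef :=
  posSemidef_of_trace_mul_nonneg fun ρ hρ => by
    rw [Matrix.trace_mul_comm, ← trace_adj]
    exact trace_mul_nonneg (hE ρ hρ).1 hM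

/-- The adjoint of a positive trace-nonincreasing super-operator, acting on predicates. -/
def adjPred {E : SuperOp V} (hE : IsSubnormal E) (M : QPred V) : QPred V :=
  ⟨adj E M.1, (posSemidef_adj hE (Matrix.nonneg_iff_posSemidef.mp M.2.1)).nonneg, by
    refine le_of_expect_le (Matrix.isHermitian_one.sub
      (posSemidef_adj hE (Matrix.nonneg_iff_posSemidef.mp M.2.1)).isHermitian) fun ρ hρ => ?_
    rw [expect_adj, expect_one]
    exact (expect_mono M.2.2 (hE ρ hρ).1).trans ((expect_one _).trans_le (hE ρ hρ).2)⟩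

theorem expect_adjPred {E : SuperOp V} (hE : IsSubnormal E) (M : QPred V) (ρ : Op V) :
    expect (adjPred hE M).1 ρ = expect M.1 (E ρ) := expect_adj E M.1 ρ

/-! ### Order and validity through real lower bounds -/

theorem le_exp_iff {c : ℝ} {ρ : Op V} {Θ : Assertion V} :
    (c : EReal) ≤ Exp ρ Θ ↔ IsLowerExp c ρ Θ := by
  simp [Exp, IsLowerExp, le_iInf_iff]

theorem exp_le_exp_iff {ρ σ : Op V} {Θ Ψ : Assertion V} :
    Exp ρ Θ ≤ Exp σ Ψ ↔ ∀ c : ℝ, IsLowerExp c ρ Θ → IsLowerExp c σ Ψ := by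
  simp only [← le_exp_iff]
  refine ⟨fun h c hc => hc.trans h, fun h => EReal.ge_of_forall_gt_iff_ge.mp fun z hz => ?_⟩
  exact h z hz.le

theorem leInf_iff {Θ Ψ : Assertion V} :
    LeInf Θ Ψ ↔ ∀ ρ, IsState ρ → ∀ c : ℝ, IsLowerExp c ρ Θ → IsLowerExp c ρ Ψ := by
  simp only [LeInf, exp_le_exp_iff]

theorem validTot_iff {Θ Ψ : Assertion V} {S : Prog V} :
    ValidTot Θ S Ψ ↔ ∀ ρ, IsState ρ → ∀ c : ℝ, IsLowerExp c ρ Θ →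
      ∀ E ∈ sem S, IsLowerExp c (E ρ) Ψ := by
  simp only [ValidTot, le_iInf_iff, Set.forall_mem_image, exp_le_exp_iff]
  exact forall₂_congr fun ρ _ => ⟨fun h c hc E hE => h hE c hc, fun h E hE c hc => h c hc E hE⟩

/- ## Measurements -/

section
variable {n : ℕ} (q : Fin n ↪ V) (M : Measurement n)

theorem trace_meas0_mul (A ρ : Op V) : (meas0 q M A * ρ).trace = (A * meas0 q M ρ).trace := by
  rw [meas0, trace_conj_mul, ← cyl_conjTranspose, M.herm0]

theorem trace_meas1_mul (A ρ : Op V) : (meas1 q M A * ρ).trace = (A * meas1 q M ρ).trace := by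
  rw [meas1, trace_conj_mul, ← cyl_conjTranspose, M.herm1]

theorem expect_measPred (N T : QPred V) (ρ : Op V) :
    expect (measPred q M N T).1 ρ = expect N.1 (meas0 q M ρ) + expect T.1 (meas1 q M ρ) := by
  rw [measPred, expect_add_left, expect, trace_meas0_mul, expect, trace_meas1_mul]
  rfl

theorem trace_meas_add (ρ : Op V) : (meas0 q M ρ).trace + (meas1 q M ρ).trace = ρ.trace := by
  have h0 : (meas0 q M ρ).trace = (cyl q M.P0 * ρ).trace := by
    rw [← Matrix.one_mul (meas0 q M ρ), ← trace_meas0_mul, meas0, conj]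
    simp [← cyl_conjTranspose, M.herm0, ← cyl_mul, M.idem0]
  have h1 : (meas1 q M ρ).trace = (cyl q M.P1 * ρ).trace := by
    rw [← Matrix.one_mul (meas1 q M ρ), ← trace_meas1_mul, meas1, conj]
    simp [← cyl_conjTranspose, M.herm1, ← cyl_mul, M.idem1]
  rw [h0, h1, ← Matrix.trace_add, ← Matrix.add_mul, ← cyl_add, M.complete, cyl_one, Matrix.one_mul]

theorem posSemidef_conj (A : Op V) {ρ : Op V} (h : ρ.PosSemidef) : (conj A ρ).PosSemidef :=
  h.mul_mul_conjTranspose_same A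

theorem trace_re_meas_add (ρ : Op V) :
    (meas0 q M ρ).trace.re + (meas1 q M ρ).trace.re = ρ.trace.re := by
  rw [← Complex.add_re, trace_meas_add]

theorem trace_re_nonneg {ρ : Op V} (h : ρ.PosSemidef) : 0 ≤ ρ.trace.re :=
  (Complex.nonneg_iff.mp h.trace_nonneg).1

theorem posSemidef_meas1 {ρ : Op V} (h : ρ.PosSemidef) : (meas1 q M ρ).PosSemidef :=
  posSemidef_conj _ h

theorem isSubnormal_meas0 : IsSubnormal (meas0 q M) := fun ρ hρ =>
  ⟨posSemidef_conj _ hρ, by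
    linarith [trace_re_meas_add q M ρ, trace_re_nonneg (posSemidef_meas1 q M hρ)]⟩

theorem isSubnormal_meas1 : IsSubnormal (meas1 q M) := fun ρ hρ =>
  ⟨posSemidef_meas1 q M hρ, by
    linarith [trace_re_meas_add q M ρ, trace_re_nonneg (isSubnormal_meas0 q M ρ hρ).1]⟩

theorem expect_initPred (N : QPred V) (ρ : Op V) :
    expect (initPred q N).1 ρ = expect N.1 (setZero q ρ) := by
  simp only [initPred, setZero, expect, Finset.sum_mul, LinearMap.sum_apply, Finset.mul_sum,
    Matrix.trace_sum, trace_conj_mul, ← cyl_conjTranspose, Matrix.conjTranspose_single, star_one]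

theorem expect_unitPred (U : Matrix.unitaryGroup (Bits (Fin n)) ℂ) (N : QPred V) (ρ : Op V) :
    expect (unitPred q U N).1 ρ = expect N.1 (conj (cyl q U.1) ρ) := by
  have := trace_conj_mul (cyl q U.1).conjTranspose N.1 ρ
  rw [Matrix.conjTranspose_conjTranspose] at this
  rw [expect, expect, ← this]
  simp [unitPred, conj]

/- ## Loops -/

/-- `loopIter` splits off the last iteration, whereas the ranking condition and the unfolding of the
loop split off the first. -/
theorem loopIter_succ_head (η : ℕ → SuperOp V) (k : ℕ) (ρ : Op V) :
    loopIter q M η (k + 1) ρ = loopIter q M (fun i => η (i + 1)) k (η 0 (meas1 q M ρ)) := by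
  induction k with
  | zero => rfl
  | succ k ih =>
    rw [loopIter, LinearMap.comp_apply, LinearMap.comp_apply, ih]
    rfl

theorem trace_backIter_mul (η : ℕ → SuperOp V) (k : ℕ) (A ρ : Op V) :
    (backIter q M η k A * ρ).trace = (A * loopIter q M η k ρ).trace := by
  induction k generalizing A with
  | zero => rfl
  | succ k ih =>
    rw [backIter, LinearMap.comp_apply, LinearMap.comp_apply, ih, trace_meas1_mul,
      Matrix.trace_mul_comm, ← trace_adj, Matrix.trace_mul_comm]
    rfl

end

/-! ### Limits of positive operators -/

theorem posSemidef_of_hasSum {f : ℕ → Op V} {A : Op V} (h : HasSum f A)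
    (hf : ∀ k, (f k).PosSemidef) : A.PosSemidef := by
  refine posSemidef_of_trace_mul_nonneg fun ρ hρ => ?_
  have h1 : HasSum (fun k => (f k * ρ).trace) (A * ρ).trace := by
    refine h.map (AddMonoidHom.mk' (fun M : Op V => (M * ρ).trace) fun M N => by
      simp [Matrix.add_mul]) ?_
    change Continuous fun M : Op V => (M * ρ).trace
    fun_prop
  exact h1.nonneg fun k => trace_mul_nonneg (hf k) hρ

/-- A decreasing sequence of predicates with infimum `0` tends to `0` in expectation. -/
theorem tendsto_expect_of_isGLB_zero {f : ℕ → QPred V} (hf : ∀ i, (f (i + 1)).1 ≤ (f i).1)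
    (h0 : IsGLB (Set.range fun i => (f i).1) 0) {ρ : Op V} (hρ : ρ.PosSemidef) :
    Filter.Tendsto (fun i => expect (f i).1 ρ) Filter.atTop (nhds 0) := by
  have hg : ∀ i, ((f i).1 - (f (i + 1)).1).PosSemidef := fun i => Matrix.le_iff.mp (hf i)
  -- The decrements are positive with telescoping, bounded traces, so `f` converges to `f 0 - s`.
  -- This limit is a lower bound of the sequence, hence at most the infimum `0`.
  obtain ⟨s, hs⟩ : Summable fun i => (f i).1 - (f (i + 1)).1 := by
    refine summable_of_trace_le (c := (f 0).1.trace.re) hg fun n => ?_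
    simp only [Matrix.trace_sub, Complex.sub_re]
    rw [Finset.sum_range_sub' fun i => (f i).1.trace.re]
    linarith [trace_re_nonneg (Matrix.nonneg_iff_posSemidef.mp (f n).2.1)]
  have hle : (f 0).1 - s ≤ 0 := by
    refine h0.2 ?_
    rintro _ ⟨n, rfl⟩
    have h1 := posSemidef_of_hasSum ((hasSum_nat_add_iff' n).mpr hs) fun k => hg (k + n)
    rw [Finset.sum_range_sub' fun i => (f i).1] at h1
    rw [Matrix.le_iff]
    rwa [sub_sub_eq_add_sub, add_comm, ← sub_sub_eq_add_sub]
  have ht : Filter.Tendsto (fun i => expect (f i).1 ρ) Filter.atTop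
      (nhds (expect ((f 0).1 - s) ρ)) := by
    have h1 := (hasSum_expect_left hs ρ).tendsto_sum_nat
    simp only [expect_sub_left] at h1 ⊢
    simp only [Finset.sum_range_sub' fun i => expect (f i).1 ρ] at h1
    simpa using h1.const_sub (expect (f 0).1 ρ)
  have h2 := expect_mono hle hρ
  have h3 := ge_of_tendsto' ht fun i => expect_nonneg (f i).2.1 hρ
  have h4 : expect 0 ρ = 0 := by simp [expect]
  rwa [le_antisymm (h2.trans_eq h4) h3] at ht

/-! ### Convergence and subnormality of the semantics -/

section
variable {n : ℕ} (q : Fin n ↪ V) (M : Measurement n)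

theorem isSubnormal_loopIter {η : ℕ → SuperOp V} (hη : ∀ i, IsSubnormal (η i)) (k : ℕ) :
    IsSubnormal (loopIter q M η k) := by
  induction k with
  | zero => exact fun ρ hρ => ⟨hρ, le_rfl⟩
  | succ k ih =>
    intro ρ hρ
    have h1 := ih ρ hρ
    have h2 := isSubnormal_meas1 q M _ h1.1
    have h3 := hη k _ h2.1
    exact ⟨h3.1, h3.2.trans (h2.2.trans h1.2)⟩

theorem sum_trace_loopIter_le {η : ℕ → SuperOp V} (hη : ∀ i, IsSubnormal (η i)) {ρ : Op V}
    (hρ : ρ.PosSemidef) (k : ℕ) :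
    ∑ j ∈ Finset.range k, (meas0 q M (loopIter q M η j ρ)).trace.re ≤ ρ.trace.re := by
  -- The induction needs the mass still inside the loop to be counted along with the mass that has
  -- left.
  suffices h : ∑ j ∈ Finset.range k, (meas0 q M (loopIter q M η j ρ)).trace.re +
      (loopIter q M η k ρ).trace.re ≤ ρ.trace.re by
    linarith [trace_re_nonneg (isSubnormal_loopIter q M hη k ρ hρ).1]
  induction k with
  | zero => simp [loopIter]
  | succ k ih =>
    have h1 := isSubnormal_meas1 q M _ (isSubnormal_loopIter q M hη k ρ hρ).1
    have h2 : (loopIter q M η (k + 1) ρ).trace.re ≤ _ := (hη k _ h1.1).2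
    rw [Finset.sum_range_succ]
    linarith [trace_re_meas_add q M (loopIter q M η k ρ)]

theorem summable_loopIter {η : ℕ → SuperOp V} (hη : ∀ i, IsSubnormal (η i)) (ρ : Op V) :
    Summable fun k => meas0 q M (loopIter q M η k ρ) := by
  -- The trace bound applies to positive `ρ` only; these span all operators, and summability is
  -- linear.
  have hρ : ρ ∈ Submodule.span ℂ {a : Op V | 0 ≤ a} := by
    open scoped Matrix.Norms.L2Operator in rw [CStarAlgebra.span_nonneg]
    trivial
  induction hρ using Submodule.span_induction with
  | mem ρ h =>
    have hρ : ρ.PosSemidef := Matrix.nonneg_iff_posSemidef.mp h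
    exact summable_of_trace_le
      (fun k => (isSubnormal_meas0 q M _ (isSubnormal_loopIter q M hη k ρ hρ).1).1)
      (sum_trace_loopIter_le q M hη hρ)
  | zero => simp
  | add ρ σ _ _ h1 h2 => simpa using h1.add h2
  | smul c ρ _ h => simpa using h.const_smul c

theorem exists_hasSum_loopIter {η : ℕ → SuperOp V} (hη : ∀ i, IsSubnormal (η i)) :
    ∃ G : SuperOp V, ∀ ρ, HasSum (fun k => meas0 q M (loopIter q M η k ρ)) (G ρ) :=
  ⟨{ toFun ρ := ∑' k, meas0 q M (loopIter q M η k ρ)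
     map_add' ρ σ := by
       simp only [map_add]
       exact (summable_loopIter q M hη ρ).tsum_add (summable_loopIter q M hη σ)
     map_smul' c ρ := by
       simp only [map_smul, RingHom.id_apply]
       exact (summable_loopIter q M hη ρ).tsum_const_smul c },
    fun ρ => (summable_loopIter q M hη ρ).hasSum⟩

theorem isSubnormal_of_hasSum_loopIter {η : ℕ → SuperOp V} (hη : ∀ i, IsSubnormal (η i))
    {G : SuperOp V} (hG : ∀ ρ, HasSum (fun k => meas0 q M (loopIter q M η k ρ)) (G ρ)) :
    IsSubnormal G := fun ρ hρ => by
  refine ⟨posSemidef_of_hasSum (hG ρ) fun k =>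
    (isSubnormal_meas0 q M _ (isSubnormal_loopIter q M hη k ρ hρ).1).1, ?_⟩
  have h := (hasSum_expect_right (hG ρ) 1).tendsto_sum_nat
  simp only [expect_one] at h
  exact le_of_tendsto' h (sum_trace_loopIter_le q M hη hρ)

theorem isSubnormal_setZero : IsSubnormal (setZero q) := fun ρ hρ => by
  constructor
  · rw [setZero, LinearMap.sum_apply]
    exact Matrix.posSemidef_sum _ fun i _ => posSemidef_conj _ hρ
  · rw [← expect_one, ← expect_one, ← expect_initPred q ⟨1, zero_le_one, le_rfl⟩]
    exact expect_mono (initPred q _).2.2 hρ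

theorem isSubnormal_unit (U : Matrix.unitaryGroup (Bits (Fin n)) ℂ) :
    IsSubnormal (conj (cyl q U.1)) := fun ρ hρ => by
  refine ⟨posSemidef_conj _ hρ, ?_⟩
  rw [← expect_one, ← expect_one, ← expect_unitPred q U ⟨1, zero_le_one, le_rfl⟩]
  exact expect_mono (unitPred q U _).2.2 hρ

end

theorem isSubnormal_of_mem_sem {S : Prog V} {E : SuperOp V} (hE : E ∈ sem S) :
    IsSubnormal E := by
  induction S generalizing E with
  | skip => rw [sem, Set.mem_singleton_iff] at hE; subst hE; exact fun ρ hρ => ⟨hρ, le_rfl⟩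
  | abort =>
    rw [sem, Set.mem_singleton_iff] at hE; subst hE
    exact fun ρ hρ => ⟨Matrix.PosSemidef.zero, by simpa using trace_re_nonneg hρ⟩
  | init q => rw [sem, Set.mem_singleton_iff] at hE; subst hE; exact isSubnormal_setZero q
  | unit q U => rw [sem, Set.mem_singleton_iff] at hE; subst hE; exact isSubnormal_unit q U
  | seq S₀ S₁ ih₀ ih₁ =>
    rw [sem] at hE
    obtain ⟨E, hE, F, hF, rfl⟩ := hE
    intro ρ hρ
    have h0 := ih₀ hE ρ hρ
    have h1 := ih₁ hF _ h0.1
    exact ⟨h1.1, h1.2.trans h0.2⟩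
  | choice S₀ S₁ ih₀ ih₁ =>
    rw [sem] at hE
    exact hE.elim (fun h => ih₀ h) fun h => ih₁ h
  | ite q M S₁ S₀ ih₁ ih₀ =>
    rw [sem] at hE
    obtain ⟨E, hE, F, hF, rfl⟩ := hE
    intro ρ hρ
    have h0 := ih₀ hE _ (isSubnormal_meas0 q M ρ hρ).1
    have h1 := ih₁ hF _ (isSubnormal_meas1 q M ρ hρ).1
    refine ⟨h0.1.add h1.1, ?_⟩
    simp only [LinearMap.add_apply, LinearMap.comp_apply, Matrix.trace_add, Complex.add_re]
    linarith [trace_re_meas_add q M ρ]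
  | _ q M S ih =>
    rw [sem] at hE
    obtain ⟨η, hη, hG⟩ := hE
    exact isSubnormal_of_hasSum_loopIter q M (fun i => ih (hη i)) hG

/-- The semantics admits a scheduler only together with a limit of its series; convergence shows
that every scheduler contributes one. -/
theorem exists_mem_sem_while {n : ℕ} (q : Fin n ↪ V) (M : Measurement n) {S : Prog V}
    (η : Scheduler S) : ∃ G ∈ sem (.while q M S),
      ∀ ρ : Op V, HasSum (fun k => meas0 q M (loopIter q M (fun i => (η i).1) k ρ)) (G ρ) := by
  obtain ⟨G, hG⟩ := exists_hasSum_loopIter q M fun i => isSubnormal_of_mem_sem (η i).2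
  refine ⟨G, ?_, hG⟩
  rw [sem]
  exact ⟨_, fun i => (η i).2, hG⟩

/- ## The ranking assertion of a loop -/

section
variable {n : ℕ} (q : Fin n ↪ V) (M : Measurement n) {S : Prog V}

theorem trace_termOp_mul (η : Scheduler S) (k : ℕ) (ρ : Op V) :
    (termOp q M η k * ρ).trace = (meas0 q M (loopIter q M (fun i => (η i).1) k ρ)).trace := by
  rw [termOp, trace_backIter_mul, trace_meas0_mul, Matrix.one_mul]

theorem expect_termOp (η : Scheduler S) (k : ℕ) (ρ : Op V) :
    expect (termOp q M η k) ρ =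
      (meas0 q M (loopIter q M (fun i => (η i).1) k ρ)).trace.re := by
  rw [expect, trace_termOp_mul]

theorem posSemidef_termOp (η : Scheduler S) (k : ℕ) : (termOp q M η k).PosSemidef :=
  posSemidef_of_trace_mul_nonneg fun ρ hρ => by
    rw [trace_termOp_mul]
    exact (isSubnormal_meas0 q M _ (isSubnormal_loopIter q M
      (fun i => isSubnormal_of_mem_sem (η i).2) k ρ hρ).1).1.trace_nonneg

theorem sum_expect_termOp_le (η : Scheduler S) {ρ : Op V} (hρ : ρ.PosSemidef) (k : ℕ) :
    ∑ j ∈ Finset.range k, expect (termOp q M η j) ρ ≤ ρ.trace.re := by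
  simp only [expect_termOp]
  exact sum_trace_loopIter_le q M (fun i => isSubnormal_of_mem_sem (η i).2) hρ k

theorem summable_termOp (η : Scheduler S) : Summable (termOp q M η) :=
  summable_of_trace_le (c := (1 : Op V).trace.re) (posSemidef_termOp q M η) fun k => by
    simpa [expect] using sum_expect_termOp_le q M η Matrix.PosSemidef.one k

theorem exists_rankPred (i : ℕ) (η : Scheduler S) :
    ∃ A : QPred V, HasSum (fun k => termOp q M η (i + k)) A.1 := by
  obtain ⟨A, hA⟩ : Summable fun k => termOp q M η (i + k) := by
    simpa only [add_comm i] using (summable_nat_add_iff i).mpr (summable_termOp q M η)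
  have hp := posSemidef_of_hasSum hA fun k => posSemidef_termOp q M η (i + k)
  refine ⟨⟨A, hp.nonneg, le_of_expect_le (Matrix.isHermitian_one.sub hp.isHermitian)
    fun ρ hρ => ?_⟩, hA⟩
  refine le_of_tendsto' (hasSum_expect_left hA ρ).tendsto_sum_nat fun k => ?_
  -- A block of `k` terms starting at `i` is at most the first `i + k` terms, as the omitted ones
  -- are nonnegative.
  have h := sum_expect_termOp_le q M η hρ (i + k)
  rw [Finset.sum_range_add] at h
  rw [expect_one]
  linarith [Finset.sum_nonneg fun j (_ : j ∈ Finset.range i) =>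
    expect_nonneg (posSemidef_termOp q M η j).nonneg hρ]

/-- `R 0 η` measures the probability of termination. It dominates the expectation of any `N ∈ Ψ` in
the output because `N ≤ 1`, which is where nonemptiness enters. The remaining conditions concern
tails of a convergent positive series; condition (3) holds with equality. -/
theorem isRanking_of_hasSum {R : ℕ → Scheduler S → QPred V}
    (hR : ∀ i η, HasSum (fun k => termOp q M η (i + k)) (R i η).1) {Θ Ψ : Assertion V}
    (hΨ : Ψ.Nonempty) (h : ValidTot Θ (.while q M S) Ψ) : IsRanking q M S Θ R where
  bound η := by
    rw [leInf_iff]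
    rintro ρ hρ c hc _ rfl
    obtain ⟨N, hN⟩ := hΨ
    obtain ⟨G, hG, hs⟩ := exists_mem_sem_while q M η
    have h1 := hasSum_expect_right (hs ρ) 1
    have h2 := hasSum_expect_left (hR 0 η) ρ
    simp only [expect_termOp, zero_add, expect_one] at h1 h2
    rw [h2.unique h1, ← expect_one]
    exact (validTot_iff.mp h ρ hρ c hc G hG N hN).trans
      (expect_mono N.2.2 (isSubnormal_of_mem_sem hG ρ hρ.1).1)
  decreasing η i := by
    have h1 : HasSum (fun k => termOp q M η (i + (k + 1))) (R (i + 1) η).1 := by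
      simpa only [add_assoc, add_comm 1] using hR (i + 1) η
    have h2 := (hasSum_nat_add_iff (f := fun k => termOp q M η (i + k)) 1).mp h1
    rw [(hR i η).unique h2]
    simpa using (posSemidef_termOp q M η i).nonneg
  inf_zero η := by
    refine ⟨?_, fun B hB => ?_⟩
    · rintro _ ⟨i, rfl⟩
      exact (R i η).2.1
    · have hB' : ∀ i, B ≤ (R i η).1 := fun i => hB ⟨i, rfl⟩
      have hh : B.IsHermitian := by
        have h1 := (Matrix.nonneg_iff_posSemidef.mp (R 0 η).2.1).isHermitian.sub
          (Matrix.le_iff.mp (hB' 0)).isHermitian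
        rwa [sub_sub_cancel] at h1
      refine le_of_expect_le (Matrix.isHermitian_zero.sub hh) fun ρ hρ => ?_
      have ht := tendsto_sum_nat_add fun k => expect (termOp q M η k) ρ
      have h0 : expect 0 ρ = 0 := by simp [expect]
      rw [h0]
      refine ge_of_tendsto' ht fun i => ?_
      have h1 := (hasSum_expect_left (hR i η) ρ).tsum_eq
      simp only [add_comm i] at h1
      rw [h1]
      exact expect_mono (hB' i) hρ
  step η i ρ _ := by
    have h1 := hasSum_expect_left (hR i (Scheduler.tail η)) ((η 0).1 (meas1 q M ρ))
    have h2 := hasSum_expect_left (hR (i + 1) η) ρ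
    simp only [expect_termOp, add_right_comm i 1, loopIter_succ_head] at h1 h2
    exact (h1.unique h2).le

end

/- ## Soundness -/

section
variable {n : ℕ} (q : Fin n ↪ V) (M : Measurement n) {S : Prog V}

/-- Condition (3) iterated: each pass through the body drops one element of the scheduler and is
paid for by one index of `R`. -/
theorem IsRanking.expect_loopIter_le {Θ : Assertion V} {R : ℕ → Scheduler S → QPred V}
    (hR : IsRanking q M S Θ R) (k i : ℕ) (η : Scheduler S) {ρ : Op V} (hρ : IsState ρ) :
    expect (R i (Scheduler.tail^[k] η)).1 (loopIter q M (fun i => (η i).1) k ρ) ≤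
      expect (R (i + k) η).1 ρ := by
  induction k generalizing η ρ with
  | zero => rfl
  | succ k ih =>
    have hs : IsState ((η 0).1 (meas1 q M ρ)) :=
      (hρ.map (isSubnormal_meas1 q M)).map (isSubnormal_of_mem_sem (η 0).2)
    rw [loopIter_succ_head]
    exact (ih (Scheduler.tail η) hs).trans (hR.step η (i + k) ρ hρ)

theorem isLowerExp_measAssert {c : ℝ} {ρ : Op V} {Θ₀ Θ₁ : Assertion V} :
    IsLowerExp c ρ (measAssert q M Θ₀ Θ₁) ↔ ∀ N ∈ Θ₀, ∀ T ∈ Θ₁,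
      c ≤ expect N.1 (meas0 q M ρ) + expect T.1 (meas1 q M ρ) := by
  simp only [← expect_measPred]
  exact ⟨fun h N hN T hT => h _ ⟨N, hN, T, hT, rfl⟩,
    by rintro h _ ⟨N, hN, T, hT, rfl⟩; exact h N hN T hT⟩

theorem validTot_while {Θ Ψ : Assertion V} (h : ValidTot Θ S (measAssert q M Ψ Θ))
    {R : ℕ → Scheduler S → QPred V} (hR : IsRanking q M S (measAssert q M Ψ Θ) R) :
    ValidTot (measAssert q M Ψ Θ) (.while q M S) Ψ := by
  rw [validTot_iff]
  intro ρ hρ c hc G hG N hN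
  rw [sem] at hG
  obtain ⟨η, hη, hG⟩ := hG
  have hst : ∀ k, IsState (loopIter q M η k ρ) := fun k =>
    hρ.map (isSubnormal_loopIter q M (fun i => isSubnormal_of_mem_sem (hη i)) k)
  have hinv : ∀ k, IsLowerExp
      (c - ∑ j ∈ Finset.range k, expect N.1 (meas0 q M (loopIter q M η j ρ)))
      (loopIter q M η k ρ) (measAssert q M Ψ Θ) := by
    intro k
    induction k with
    | zero => simpa [loopIter] using hc
    | succ k ih =>
      -- With `N` fixed, moving its term to the left leaves a lower bound valid for all `T ∈ Θ`, to
      -- which validity of the body applies.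
      refine validTot_iff.mp h _ ((hst k).map (isSubnormal_meas1 q M)) _ ?_ _ (hη k)
      intro T hT
      have := (isLowerExp_measAssert q M).mp ih N hN T hT
      rw [Finset.sum_range_succ]
      linarith
  let η' : Scheduler S := fun i => ⟨η i, hη i⟩
  have hle : ∀ k, c - ∑ j ∈ Finset.range k, expect N.1 (meas0 q M (loopIter q M η j ρ)) ≤
      expect (R k η').1 ρ := fun k => by
    have h1 := leInf_iff.mp (hR.bound (Scheduler.tail^[k] η')) _ (hst k) _ (hinv k) _ rfl
    have h2 := hR.expect_loopIter_le q M k 0 η' hρ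
    rw [zero_add] at h2
    exact h1.trans h2
  have ht := tendsto_expect_of_isGLB_zero (hR.decreasing η') (hR.inf_zero η') hρ.1
  have hs := (hasSum_expect_right (hG ρ) N.1).tendsto_sum_nat
  linarith [le_of_tendsto_of_tendsto' (hs.const_sub c) ht hle]

end

theorem ProvableTot.validTot {S : Prog V} {Θ Ψ : Assertion V} (h : ProvableTot Θ S Ψ) :
    ValidTot Θ S Ψ := by
  induction h with
  | skip Θ =>
    rw [validTot_iff]
    intro ρ _ c hc E hE
    rw [sem, Set.mem_singleton_iff] at hE
    subst hE
    exact hc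
  | abortT =>
    rw [validTot_iff]
    rintro ρ _ c hc E hE _ rfl
    have h0 : ∀ σ : Op V, expect (0 : QPred V).1 σ = 0 := fun σ => by
      change expect 0 σ = 0
      simp [expect]
    exact (hc 0 rfl).trans_eq ((h0 _).trans (h0 _).symm)
  | init q Θ =>
    rw [validTot_iff]
    intro ρ _ c hc E hE N hN
    rw [sem, Set.mem_singleton_iff] at hE
    subst hE
    rw [← expect_initPred]
    exact hc _ ⟨N, hN, rfl⟩
  | unit q U Θ =>
    rw [validTot_iff]
    intro ρ _ c hc E hE N hN
    rw [sem, Set.mem_singleton_iff] at hE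
    subst hE
    rw [← expect_unitPred]
    exact hc _ ⟨N, hN, rfl⟩
  | seq _ _ ih₀ ih₁ =>
    rw [validTot_iff] at *
    intro ρ hρ c hc G hG
    rw [sem] at hG
    obtain ⟨E, hE, F, hF, rfl⟩ := hG
    exact ih₁ _ (hρ.map (isSubnormal_of_mem_sem hE)) c (ih₀ ρ hρ c hc E hE) F hF
  | ndet _ _ ih₀ ih₁ =>
    rw [validTot_iff] at *
    intro ρ hρ c hc G hG
    rw [sem] at hG
    exact hG.elim (ih₀ ρ hρ c hc G) (ih₁ ρ hρ c hc G)
  | @meas n q M S₁ S₀ Θ₀ Θ₁ Ψ _ _ ih₁ ih₀ =>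
    rw [validTot_iff] at *
    intro ρ hρ c hc G hG N hN
    rw [sem] at hG
    obtain ⟨E, hE, F, hF, rfl⟩ := hG
    rw [isLowerExp_measAssert] at hc
    rw [LinearMap.add_apply, LinearMap.comp_apply, LinearMap.comp_apply, expect_add_right]
    -- The branches are treated in turn: fixing `T` gives a bound for `Θ₀`, and the result, read for
    -- all `T`, is a bound for `Θ₁`.
    have h0 : ∀ T ∈ Θ₁,
        c - expect T.1 (meas1 q M ρ) ≤ expect N.1 (E (meas0 q M ρ)) := fun T hT =>
      ih₀ _ (hρ.map (isSubnormal_meas0 q M)) _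
        (fun L hL => by linarith [hc L hL T hT]) E hE N hN
    have h1 := ih₁ _ (hρ.map (isSubnormal_meas1 q M)) (c - expect N.1 (E (meas0 q M ρ)))
      (fun T hT => by linarith [h0 T hT]) F hF N hN
    linarith
  | whileT q M _ hR ih =>
    obtain ⟨R, hR⟩ := hR
    exact validTot_while q M ih hR
  | imp hΘ _ hΨ ih =>
    rw [validTot_iff] at *
    rw [leInf_iff] at hΘ hΨ
    exact fun ρ hρ c hc E hE =>
      hΨ _ (hρ.map (isSubnormal_of_mem_sem hE)) c (ih ρ hρ c (hΘ ρ hρ c hc) E hE)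
  | union Θ Ψ _ ih =>
    rw [validTot_iff]
    intro ρ hρ c hc E hE N hN
    obtain ⟨i, hi⟩ := Set.mem_iUnion.mp hN
    exact validTot_iff.mp (ih i) ρ hρ c (fun L hL => hc L (Set.mem_iUnion.mpr ⟨i, hL⟩)) E hE N hi

/- ## Completeness -/

/-- The weakest precondition `{E†(N) : E ∈ ⟦S⟧, N ∈ Ψ}`. -/
def wp (S : Prog V) (Ψ : Assertion V) : Assertion V :=
  {A | ∃ E, ∃ hE : E ∈ sem S, ∃ N ∈ Ψ, A = adjPred (isSubnormal_of_mem_sem hE) N}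

theorem isLowerExp_wp {S : Prog V} {Ψ : Assertion V} {c : ℝ} {ρ : Op V} :
    IsLowerExp c ρ (wp S Ψ) ↔ ∀ E ∈ sem S, IsLowerExp c (E ρ) Ψ := by
  constructor
  · intro h E hE N hN
    rw [← expect_adjPred (isSubnormal_of_mem_sem hE)]
    exact h _ ⟨E, hE, N, hN, rfl⟩
  · rintro h _ ⟨E, hE, N, hN, rfl⟩
    rw [expect_adjPred]
    exact h E hE N hN

theorem isLowerExp_singleton {N : QPred V} {c : ℝ} {ρ : Op V} :
    IsLowerExp c ρ {N} ↔ c ≤ expect N.1 ρ := by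
  simp only [IsLowerExp, Set.mem_singleton_iff, forall_eq]

theorem validTot_iff_leInf_wp {S : Prog V} {Θ Ψ : Assertion V} :
    ValidTot Θ S Ψ ↔ LeInf Θ (wp S Ψ) := by
  simp only [validTot_iff, leInf_iff, isLowerExp_wp]

theorem LeInf.refl (Θ : Assertion V) : LeInf Θ Θ := fun _ _ => le_rfl

/-- The Union rule, with the empty family covering `Ψ = ∅`. -/
theorem ProvableTot.of_singletons {S : Prog V}
    (h : ∀ N : QPred V, ProvableTot (wp S {N}) S {N}) (Ψ : Assertion V) :
    ProvableTot (wp S Ψ) S Ψ := by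
  have h1 := ProvableTot.union (S := S) (I := Ψ) _ _ fun N => h N.1
  have h2 : (⋃ N : Ψ, ({N.1} : Assertion V)) = Ψ := Set.iUnion_of_singleton_coe Ψ
  rw [h2] at h1
  refine ProvableTot.imp ?_ h1 (LeInf.refl _)
  rw [leInf_iff]
  intro ρ _ c hc A hA
  obtain ⟨N, E, hE, _, rfl, rfl⟩ := Set.mem_iUnion.mp hA
  exact hc _ ⟨E, hE, N.1, N.2, rfl⟩

/-- One unfolding of the loop: a scheduler is its first element followed by its tail, and the `k =
0` term of the series is `P⁰`. -/
theorem mem_sem_while_iff {n : ℕ} {q : Fin n ↪ V} {M : Measurement n} {S : Prog V}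
    {G : SuperOp V} : G ∈ sem (.while q M S) ↔
      ∃ E ∈ sem S, ∃ F ∈ sem (.while q M S), G = meas0 q M + F ∘ₗ E ∘ₗ meas1 q M := by
  have key : ∀ (η : ℕ → SuperOp V) (F : SuperOp V),
      (∀ ρ, HasSum (fun k => meas0 q M (loopIter q M (fun i => η (i + 1)) k ρ)) (F ρ)) →
      ∀ ρ, HasSum (fun k => meas0 q M (loopIter q M η k ρ))
        ((meas0 q M + F ∘ₗ η 0 ∘ₗ meas1 q M) ρ) := by
    intro η F hF ρ
    have h1 := hF (η 0 (meas1 q M ρ))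
    simp only [← loopIter_succ_head] at h1
    have h2 := (hasSum_nat_add_iff (f := fun k => meas0 q M (loopIter q M η k ρ)) 1).mp h1
    rw [Finset.sum_range_one, add_comm] at h2
    exact h2
  constructor
  · intro hG
    rw [sem] at hG
    obtain ⟨η, hη, hG⟩ := hG
    obtain ⟨F, hF, hs⟩ := exists_mem_sem_while q M (S := S) fun i => ⟨η (i + 1), hη (i + 1)⟩
    exact ⟨η 0, hη 0, F, hF, LinearMap.ext fun ρ => (hG ρ).unique (key η F hs ρ)⟩
  · rintro ⟨E, hE, F, hF, rfl⟩
    rw [sem] at hF ⊢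
    obtain ⟨η, hη, hs⟩ := hF
    let η' : ℕ → SuperOp V
      | 0 => E
      | i + 1 => η i
    refine ⟨η', fun i => ?_, key η' F hs⟩
    cases i with
    | zero => exact hE
    | succ i => exact hη i

/-- The fixed-point equation of `wp`, up to `⊑_inf` in both directions. With a single `N`, the exit
branch and the continuing branch cannot choose different postconditions. -/
theorem isLowerExp_wp_while {n : ℕ} {q : Fin n ↪ V} {M : Measurement n} {S : Prog V}
    {N : QPred V} {c : ℝ} {ρ : Op V} :
    IsLowerExp c ρ (measAssert q M {N} (wp S (wp (.while q M S) {N}))) ↔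
      IsLowerExp c ρ (wp (.while q M S) {N}) := by
  have h1 : IsLowerExp c ρ (measAssert q M {N} (wp S (wp (.while q M S) {N}))) ↔
      IsLowerExp (c - expect N.1 (meas0 q M ρ)) (meas1 q M ρ)
        (wp S (wp (.while q M S) {N})) := by
    rw [isLowerExp_measAssert]
    simp only [Set.mem_singleton_iff, forall_eq, IsLowerExp, sub_le_iff_le_add']
  simp only [h1, isLowerExp_wp, isLowerExp_singleton, sub_le_iff_le_add']
  constructor
  · intro h G hG
    obtain ⟨E, hE, F, hF, rfl⟩ := mem_sem_while_iff.mp hG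
    exact (h E hE F hF).trans_eq (expect_add_right _ _ _).symm
  · intro h E hE F hF
    exact (h _ (mem_sem_while_iff.mpr ⟨E, hE, F, hF, rfl⟩)).trans_eq (expect_add_right _ _ _)

theorem ProvableTot.wp_while {n : ℕ} (q : Fin n ↪ V) (M : Measurement n) {S : Prog V}
    (ih : ∀ Ψ, ProvableTot (wp S Ψ) S Ψ) (N : QPred V) :
    ProvableTot (wp (.while q M S) {N}) (.while q M S) {N} := by
  have hle : LeInf (wp (.while q M S) {N})
      (measAssert q M {N} (wp S (wp (.while q M S) {N}))) :=
    leInf_iff.mpr fun ρ _ c => isLowerExp_wp_while.mpr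
  have hge : LeInf (measAssert q M {N} (wp S (wp (.while q M S) {N})))
      (wp (.while q M S) {N}) :=
    leInf_iff.mpr fun ρ _ c => isLowerExp_wp_while.mp
  choose R hR using exists_rankPred q M (S := S)
  -- The invariant is `wp S (wp W {N})` for the loop `W`. `hle` adapts the body's postcondition and
  -- the final precondition; `hge` makes the rule's precondition valid, as the ranking assertion
  -- requires.
  exact .imp hle (.whileT q M (.imp (LeInf.refl _) (ih _) hle)
    ⟨R, isRanking_of_hasSum q M hR (Set.singleton_nonempty N) (validTot_iff_leInf_wp.mpr hge)⟩) (LeInf.refl _)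

theorem ProvableTot.wp (S : Prog V) (Ψ : Assertion V) : ProvableTot (wp S Ψ) S Ψ := by
  induction S generalizing Ψ with
  | skip =>
    refine .imp ?_ (.skip Ψ) (LeInf.refl _)
    rw [leInf_iff]
    intro ρ _ c hc
    exact isLowerExp_wp.mp hc LinearMap.id (by rw [sem]; rfl)
  | abort =>
    -- For `Ψ = ∅` the weakest precondition is `∅`, and `∅ ⊑_inf {0}` fails, so AbortT with Imp
    -- alone would not do.
    refine .of_singletons (fun N => ?_) Ψ
    have h0 : ∀ σ : Op V, expect (0 : QPred V).1 σ = 0 := fun σ => by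
      change expect 0 σ = 0
      simp [expect]
    refine .imp ?_ .abortT ?_
    · rw [leInf_iff]
      intro ρ _ c hc
      have := isLowerExp_wp.mp hc 0 (by rw [sem]; rfl)
      rw [isLowerExp_singleton] at this ⊢
      rw [h0]
      simpa [expect] using this
    · rw [leInf_iff]
      intro ρ hρ c hc
      rw [isLowerExp_singleton] at hc ⊢
      exact hc.trans ((h0 ρ).trans_le (expect_nonneg N.2.1 hρ.1))
  | init q =>
    refine .imp ?_ (.init q Ψ) (LeInf.refl _)
    rw [leInf_iff]
    rintro ρ _ c hc _ ⟨N, hN, rfl⟩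
    rw [expect_initPred]
    exact isLowerExp_wp.mp hc _ (by rw [sem]; rfl) N hN
  | unit q U =>
    refine .imp ?_ (.unit q U Ψ) (LeInf.refl _)
    rw [leInf_iff]
    rintro ρ _ c hc _ ⟨N, hN, rfl⟩
    rw [expect_unitPred]
    exact isLowerExp_wp.mp hc _ (by rw [sem]; rfl) N hN
  | seq S₀ S₁ ih₀ ih₁ =>
    refine .imp ?_ (.seq (ih₀ _) (ih₁ Ψ)) (LeInf.refl _)
    rw [leInf_iff]
    intro ρ _ c hc
    simp only [isLowerExp_wp] at hc ⊢
    exact fun E hE F hF => hc (F ∘ₗ E) (by rw [sem]; exact ⟨E, hE, F, hF, rfl⟩)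
  | choice S₀ S₁ ih₀ ih₁ =>
    refine .ndet (.imp ?_ (ih₀ Ψ) (LeInf.refl _)) (.imp ?_ (ih₁ Ψ) (LeInf.refl _))
    all_goals
      rw [leInf_iff]
      intro ρ _ c hc
      rw [isLowerExp_wp] at hc ⊢
      rw [sem] at hc
    · exact fun E hE => hc E (.inl hE)
    · exact fun E hE => hc E (.inr hE)
  | ite q M S₁ S₀ ih₁ ih₀ =>
    -- The Meas rule pairs the branch preconditions independently; only for a singleton must both
    -- come from the same `N`.
    refine .of_singletons (fun N => ?_) Ψ
    refine .imp ?_ (.meas q M (ih₁ {N}) (ih₀ {N})) (LeInf.refl _)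
    rw [leInf_iff]
    intro ρ _ c hc
    rw [isLowerExp_measAssert]
    rintro _ ⟨E, hE, L, hL, rfl⟩ _ ⟨F, hF, L', hL', rfl⟩
    obtain rfl := Set.mem_singleton_iff.mp hL
    obtain rfl := Set.mem_singleton_iff.mp hL'
    rw [expect_adjPred, expect_adjPred, ← expect_add_right]
    exact isLowerExp_wp.mp hc (E ∘ₗ meas0 q M + F ∘ₗ meas1 q M)
      (by rw [sem]; exact ⟨E, hE, F, hF, rfl⟩) _ hL
  | _ q M S ih => exact .of_singletons (.wp_while q M ih) Ψ

end
end NQP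

theorem theorem2 {V : Type*} [Fintype V] [DecidableEq V] :
    -- soundness
    (∀ (S : NQP.Prog V) (Θ Ψ : NQP.Assertion V),
      NQP.ProvableTot Θ S Ψ → NQP.ValidTot Θ S Ψ) ∧
    -- relative completeness
    (∀ (S : NQP.Prog V) (Θ Ψ : NQP.Assertion V),
      NQP.ValidTot Θ S Ψ → NQP.ProvableTot Θ S Ψ) ∧
    -- the explicit ranking assertion of a loop, which serves all its valid preconditions
    (∀ (n : ℕ) (q : Fin n ↪ V) (M : NQP.Measurement n) (S : NQP.Prog V),
      ∃ R : ℕ → NQP.Scheduler S → NQP.QPred V,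
        (∀ i η, HasSum (fun k => NQP.termOp q M η (i + k)) (R i η).1) ∧
        ∀ Θ Ψ : NQP.Assertion V, Ψ.Nonempty → NQP.ValidTot Θ (.while q M S) Ψ →
          NQP.IsRanking q M S Θ R) := by
  refine ⟨fun S Θ Ψ h => h.validTot, fun S Θ Ψ h => ?_, fun n q M S => ?_⟩
  · exact .imp (NQP.validTot_iff_leInf_wp.mp h) (.wp S Ψ) (.refl Ψ)
  · choose R hR using NQP.exists_rankPred q M (S := S)
    exact ⟨R, hR, fun Θ Ψ hΨ h => NQP.isRanking_of_hasSum q M hR hΨ h⟩
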